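/- For $n\in\mathbb N=\{0,1,2,\dots\}$ let $\mathrm{supp}(n)$ be the set of positions of the digit $1$ in the binary expansion of $n$ (so $\mathrm{supp}(0)=\emptyset$), let $B_k=\{2^k,2^k+1,\dots,2^{k+1}-1\}$ for $k\in\mathbb N$, and let $$A=\{n\in\mathbb N : B_k\setminus\mathrm{supp}(n)\neq\emptyset\text{ for every }k\in\mathbb N\}\subseteq\mathbb Z .$$ Let $T$ be the complete theory of the structure $(\mathbb Z,+,A)$ in the language $\{+,\mathbb A\}$, where $\mathbb A$ is a unary predicate. For $M\models T$, let $G(M)$ be the group $(M,+)$, which is commutative, and $\mathbb A(M)$ the interpretation of $\mathbb A$. "Definable" means definable with parameters. Definitions, for $M\models T$ and $X\subseteq G(M)$: * $X$ is a *J-set* if for every finite set $F$ of sequences $f:\mathbb N\to G(M)$ there are $m\ge 1$, $t(1)<\dots<t(m)$ in $\mathbb N$ and $a(1),\dots,a(m+1)\in G(M)$ such that for every $f\in F$, $$a(1)+f(t(1))+a(2)+f(t(2))+\dots+a(m)+f(t(m))+a(m+1)\in X.$$ * $X$ is *generic* if finitely many translates of $X$ cover $G(M)$, and *weakly generic* if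 $X\cup Y$ is generic for some definable non-generic $Y\subseteq G(M)$. * $M$ is *$\aleph_0$-saturated* if every set of formulas in one variable over a finite set of parameters of $M$ that is finitely satisfiable in $M$ is realized in $M$. * The definable group $G$ in $T$ has the *J-property* if in some (equivalently, any) $\aleph_0$-saturated model $M$ of $T$ the definable J-sets of $G(M)$ are exactly the definable weakly generic sets of $G(M)$. **Proposition.** For every $\aleph_0$-saturated model $M$ of $T$ (in particular, for a monster model $\mathbb M$), $\mathbb A(M)$ is a J-set of $G(M)$ and is not weakly generic in $G(M)$. Hence the commutative group $G$ in $T$ does not have the J-property: there is no $\aleph_0$-saturated model of $T$ in which the definable J-sets are exactly the definable weakly generic sets, and it is not the case that they coincide in every $\aleph_0$-saturated model of $T$ (so that $\aleph_0$-saturated models exist). -/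

import Mathlib

open FirstOrder

universe u v w

namespace JProp

/-! ### Large subsets of a group (written additively, not assumed commutative) -/

section Groups

variable {G : Type w} [AddGroup G]

/-- The ordered sum `a 0 + f (t 0) + a 1 + f (t 1) + ⋯ + a (m - 1) + f (t (m - 1)) + a m`. -/
def chi (m : ℕ) (a : Fin (m + 1) → G) (t : Fin m → ℕ) (f : ℕ → G) : G :=
  (List.ofFn fun i : Fin m => a i.castSucc + f (t i)).sum + a (Fin.last m)

/-- `X` is a J-set of `G`: for every finite set `F` of sequences in `G` there are `m ≥ 1`,
`t 0 < ⋯ < t (m - 1)` in `ℕ` and `a 0, …, a m` in `G` with `chi m a t f ∈ X` for all `f ∈ F`. -/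
def IsJSet (X : Set G) : Prop :=
  ∀ F : Finset (ℕ → G), ∃ m : ℕ, 1 ≤ m ∧ ∃ t : Fin m → ℕ, StrictMono t ∧
    ∃ a : Fin (m + 1) → G, ∀ f ∈ F, chi m a t f ∈ X

/-- `X` is generic: finitely many left translates of `X` cover `G`. -/
def IsGenericSet (X : Set G) : Prop :=
  ∃ S : Finset G, ∀ x : G, ∃ g ∈ S, ∃ y ∈ X, g + y = x

end Groups

/-! ### Definable sets and saturation -/

section Structures

variable (L : FirstOrder.Language.{u, v}) (M : Type w) [L.Structure M]

/-- `X` is definable in the structure `M`, with parameters from `M`. -/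
def IsDefinableSet {M : Type w} [L.Structure M] (X : Set M) : Prop :=
  (Set.univ : Set M).Definable₁ L X

/-- For a structure `M` that carries a group operation, `X ⊆ M` is weakly generic if `X ∪ Y` is
generic for some definable `Y` that is not generic. -/
def IsWeaklyGeneric {M : Type w} [L.Structure M] [AddGroup M] (X : Set M) : Prop :=
  ∃ Y : Set M, IsDefinableSet L Y ∧ ¬ IsGenericSet Y ∧ IsGenericSet (X ∪ Y)

/-- In `M`, the definable J-sets are exactly the definable weakly generic sets. -/
def JSetsAreWeaklyGenericSets [AddGroup M] : Prop :=
  ∀ X : Set M, IsDefinableSet L X → (IsJSet X ↔ IsWeaklyGeneric L X)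

/-- `M` is `ℵ₀`-saturated: every set of formulas in one variable, with parameters from a
finite set `P ⊆ M`, that is finitely satisfiable in `M` is realized in `M`. -/
def IsAleph0Saturated : Prop :=
  ∀ P : Set M, P.Finite → ∀ Γ : Set (L[[P]].Formula Unit),
    (∀ Δ : Finset (L[[P]].Formula Unit), (Δ : Set (L[[P]].Formula Unit)) ⊆ Γ →
      ∃ x : M, ∀ φ ∈ Δ, φ.Realize (fun _ => x)) →
    ∃ x : M, ∀ φ ∈ Γ, φ.Realize (fun _ => x)

end Structures

/-! ### The set `A` and the structure `(ℤ, +, A)` -/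

/-- The positions of the digit `1` in the binary expansion of `n`. -/
def supp (n : ℕ) : Set ℕ := {i | n.testBit i = true}

/-- The block `{2 ^ k, …, 2 ^ (k + 1) - 1}`. -/
def block (k : ℕ) : Set ℕ := Set.Ico (2 ^ k) (2 ^ (k + 1))

/-- The natural numbers whose binary support contains no block, as a set of integers. -/
def setA : Set ℤ := {z | ∃ n : ℕ, (n : ℤ) = z ∧ ∀ k : ℕ, (block k \ supp n).Nonempty}

/-- Function symbols: one binary symbol. -/
inductive FuncSym : ℕ → Type
  | add : FuncSym 2

/-- Relation symbols: one unary predicate. -/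
inductive RelSym : ℕ → Type
  | A : RelSym 1

/-- The language `{+, 𝔸}`. -/
def lang : FirstOrder.Language.{0, 0} := ⟨FuncSym, RelSym⟩

/-- The term `s + t`. -/
def addTerm {α : Type} (s t : lang.Term α) : lang.Term α :=
  FirstOrder.Language.Term.func (L := lang) FuncSym.add ![s, t]

/-- The structure `(ℤ, +, A)`. -/
instance intStructure : lang.Structure ℤ where
  funMap := fun {_} f x => match f with
    | FuncSym.add => x 0 + x 1
  RelMap := fun {_} r x => match r with
    | RelSym.A => x 0 ∈ setA

/-- The complete theory of `(ℤ, +, A)`. -/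
def theoryT : lang.Theory := lang.completeTheory ℤ

/-- The interpretation of the symbol `+` in a structure. -/
def opAdd {M : Type w} [lang.Structure M] (x y : M) : M :=
  FirstOrder.Language.Structure.funMap (L := lang) FuncSym.add ![x, y]

/-- The interpretation of the predicate `𝔸` in a structure. -/
def predA (M : Type w) [lang.Structure M] : Set M :=
  {x | FirstOrder.Language.Structure.RelMap (L := lang) RelSym.A ![x]}

theorem realize_addTerm {M : Type w} [lang.Structure M] {α : Type} (s t : lang.Term α)
    (v : α → M) : (addTerm s t).realize v = opAdd (s.realize v) (t.realize v) := by
  simp only [addTerm, opAdd, FirstOrder.Language.Term.realize]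
  congr 1
  funext i
  fin_cases i <;> rfl

theorem opAdd_int (x y : ℤ) : opAdd x y = x + y := rfl

theorem realize_of_int (M : theoryT.ModelType.{0, 0, w}) (φ : lang.Sentence) (h : ℤ ⊨ φ) :
    M ⊨ φ :=
  theoryT.realize_sentence_of_mem (by simpa [theoryT] using h)

/-! ### Every model of `theoryT` is a commutative group under the interpretation of `+` -/

theorem opAdd_assoc (M : theoryT.ModelType.{0, 0, w}) (x y z : M) :
    opAdd (opAdd x y) z = opAdd x (opAdd y z) := by
  let φ : lang.Sentence := FirstOrder.Language.BoundedFormula.all <| FirstOrder.Language.BoundedFormula.all <|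
    FirstOrder.Language.BoundedFormula.all <| FirstOrder.Language.Term.bdEqual
      (addTerm (addTerm (FirstOrder.Language.Term.var (Sum.inr 0)) (FirstOrder.Language.Term.var (Sum.inr 1)))
        (FirstOrder.Language.Term.var (Sum.inr 2)))
      (addTerm (FirstOrder.Language.Term.var (Sum.inr 0))
        (addTerm (FirstOrder.Language.Term.var (Sum.inr 1)) (FirstOrder.Language.Term.var (Sum.inr 2))))
  have key : ∀ (N : Type w) [lang.Structure N], N ⊨ φ ↔
      ∀ x y z : N, opAdd (opAdd x y) z = opAdd x (opAdd y z) := by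
    intro N _
    simp [φ, FirstOrder.Language.Sentence.Realize, FirstOrder.Language.Formula.Realize, realize_addTerm, Fin.snoc]
  have key0 : ℤ ⊨ φ := by
    simp [φ, FirstOrder.Language.Sentence.Realize, FirstOrder.Language.Formula.Realize, realize_addTerm, Fin.snoc,
      opAdd_int, add_assoc]
  exact (key M).1 (realize_of_int M φ key0) x y z

theorem opAdd_comm (M : theoryT.ModelType.{0, 0, w}) (x y : M) : opAdd x y = opAdd y x := by
  let φ : lang.Sentence := FirstOrder.Language.BoundedFormula.all <| FirstOrder.Language.BoundedFormula.all <|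
    FirstOrder.Language.Term.bdEqual
      (addTerm (FirstOrder.Language.Term.var (Sum.inr 0)) (FirstOrder.Language.Term.var (Sum.inr 1)))
      (addTerm (FirstOrder.Language.Term.var (Sum.inr 1)) (FirstOrder.Language.Term.var (Sum.inr 0)))
  have key : ∀ (N : Type w) [lang.Structure N], N ⊨ φ ↔
      ∀ x y : N, opAdd x y = opAdd y x := by
    intro N _
    simp [φ, FirstOrder.Language.Sentence.Realize, FirstOrder.Language.Formula.Realize, realize_addTerm, Fin.snoc]
  have key0 : ℤ ⊨ φ := by
    simp [φ, FirstOrder.Language.Sentence.Realize, FirstOrder.Language.Formula.Realize, realize_addTerm, Fin.snoc,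
      opAdd_int, add_comm]
  exact (key M).1 (realize_of_int M φ key0) x y

theorem exists_opAdd_zero (M : theoryT.ModelType.{0, 0, w}) :
    ∃ e : M, (∀ x : M, opAdd e x = x) ∧ ∀ x : M, ∃ y : M, opAdd y x = e := by
  let φ : lang.Sentence := FirstOrder.Language.BoundedFormula.ex <|
    (FirstOrder.Language.BoundedFormula.all <| FirstOrder.Language.Term.bdEqual
      (addTerm (FirstOrder.Language.Term.var (Sum.inr 0)) (FirstOrder.Language.Term.var (Sum.inr 1)))
      (FirstOrder.Language.Term.var (Sum.inr 1))) ⊓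
    (FirstOrder.Language.BoundedFormula.all <| FirstOrder.Language.BoundedFormula.ex <| FirstOrder.Language.Term.bdEqual
      (addTerm (FirstOrder.Language.Term.var (Sum.inr 2)) (FirstOrder.Language.Term.var (Sum.inr 1)))
      (FirstOrder.Language.Term.var (Sum.inr 0)))
  have key : ∀ (N : Type w) [lang.Structure N], N ⊨ φ ↔
      ∃ e : N, (∀ x : N, opAdd e x = x) ∧ ∀ x : N, ∃ y : N, opAdd y x = e := by
    intro N _
    simp [φ, FirstOrder.Language.Sentence.Realize, FirstOrder.Language.Formula.Realize, realize_addTerm, Fin.snoc]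
  have key0 : ℤ ⊨ φ := by
    simp only [φ, FirstOrder.Language.Sentence.Realize, FirstOrder.Language.Formula.Realize, realize_addTerm,
      opAdd_int, FirstOrder.Language.BoundedFormula.realize_ex, FirstOrder.Language.BoundedFormula.realize_inf,
      FirstOrder.Language.BoundedFormula.realize_all, FirstOrder.Language.BoundedFormula.realize_bdEqual,
      FirstOrder.Language.Term.realize_var]
    exact ⟨0, fun x => by simp [Fin.snoc], fun x => ⟨-x, by simp [Fin.snoc]⟩⟩
  exact (key M).1 (realize_of_int M φ key0)

/-- The commutative group `(M, +)` of a model `M` of the theory of `(ℤ, +, A)`: its addition is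
the interpretation of the symbol `+`. -/
noncomputable instance modelAddCommGroup (M : theoryT.ModelType.{0, 0, w}) : AddCommGroup M :=
  letI : Add M := ⟨opAdd⟩
  letI : Zero M := ⟨(exists_opAdd_zero M).choose⟩
  letI : Neg M := ⟨fun x => ((exists_opAdd_zero M).choose_spec.2 x).choose⟩
  { AddGroup.ofLeftAxioms (G := M) (opAdd_assoc M) (exists_opAdd_zero M).choose_spec.1
      (fun x => ((exists_opAdd_zero M).choose_spec.2 x).choose_spec) with
    add_comm := opAdd_comm M }

theorem model_add_def (M : theoryT.ModelType.{0, 0, w}) (x y : M) : x + y = opAdd x y := rfl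

/-- The J-property of the group `(𝕄, +)` in the theory of `(ℤ, +, A)`: in every
`ℵ₀`-saturated model, the definable J-sets are exactly the definable weakly generic sets. -/
def HasJProperty : Prop :=
  ∀ M : theoryT.ModelType.{0, 0, w}, IsAleph0Saturated lang M →
    JSetsAreWeaklyGenericSets lang M

end JProp

/-! ### Arithmetic of binary blocks: finitely many translates of `setA` miss a residue class -/

namespace JProp

/-! Not weakly generic: for any `n` shifts, block `j` can be filled with ones for the `j`-th shift,
so some residue class mod `2 ^ 2 ^ n` avoids `n` translates of `setA`
(`exists_forall_not_mem_setA`). The complement of `n` translates is thus covering, with a number of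
shifts depending only on `n`, and if `A ∪ Y` is generic then so is `Y`.

J-set: given `r` sequences, pigeonhole gives a common nonempty `H` with all sums over `H` divisible
by `2 ^ 2 ^ r`. One translate then puts all `r` sums in `setA` (`exists_translate_mem_setA`): low
blocks are handled by the congruence, and longer blocks have a position to spare for each sum.

Both bounds are uniform, so the two facts are first-order and hold in every model. A nonprincipal
ultrapower of `ℤ` supplies a saturated one. -/

theorem not_mem_setA_of_block (k : ℕ) {z : ℤ}
    (h : z / 2 ^ 2 ^ k % 2 ^ 2 ^ k = 2 ^ 2 ^ k - 1) : z ∉ setA := by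
  rintro ⟨n, rfl, hn⟩
  obtain ⟨i, hi, hni⟩ := hn k
  apply hni
  have h' : n / 2 ^ 2 ^ k % 2 ^ 2 ^ k = 2 ^ 2 ^ k - 1 := by
    zify [Nat.one_le_two_pow]
    exact h
  obtain ⟨h1, h2⟩ := hi
  have h3 : i - 2 ^ k < 2 ^ k := by
    rw [pow_succ] at h2
    omega
  have h4 : (n / 2 ^ 2 ^ k % 2 ^ 2 ^ k).testBit (i - 2 ^ k) = true := by
    rw [h', Nat.testBit_two_pow_sub_one]
    simpa using h3
  rw [Nat.testBit_mod_two_pow, Nat.testBit_div_two_pow] at h4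
  simp only [Bool.and_eq_true] at h4
  have := h4.2
  rwa [Nat.sub_add_cancel h1] at this

/-- Changing `c` by a multiple of `2 ^ 2 ^ n` sets block `n` freely and keeps the digits used for
earlier shifts. -/
theorem exists_forall_not_mem_setA (n : ℕ) (s : ℕ → ℤ) :
    ∃ c : ℤ, ∀ j < n, ∀ y : ℤ, c + s j + 2 ^ 2 ^ n * y ∉ setA := by
  induction n with
  | zero => exact ⟨0, by simp⟩
  | succ n ih =>
    obtain ⟨c, hc⟩ := ih
    have hq : (2 : ℤ) ^ 2 ^ (n + 1) = 2 ^ 2 ^ n * 2 ^ 2 ^ n := by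
      rw [← pow_add, pow_succ, mul_two]
    have hpos : (0 : ℤ) < 2 ^ 2 ^ n := by positivity
    rw [hq]
    generalize hQ : (2 : ℤ) ^ 2 ^ n = Q at *
    -- The correction makes the quotient of the `n`-th number by `Q` congruent to `-1` mod `Q`:
    -- block `n` is all ones.
    refine ⟨c + Q * (-1 - (c + s n) / Q), fun j hj y => ?_⟩
    rcases Nat.lt_succ_iff_lt_or_eq.1 hj with hj | rfl
    · have h := hc j hj (-1 - (c + s n) / Q + Q * y)
      rwa [show c + s j + Q * (-1 - (c + s n) / Q + Q * y)
        = c + Q * (-1 - (c + s n) / Q) + s j + Q * Q * y by ring] at h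
    · refine not_mem_setA_of_block j ?_
      rw [hQ]
      have h1 : c + Q * (-1 - (c + s j) / Q) + s j + Q * Q * y
          = c + s j + Q * (-1 - (c + s j) / Q + Q * y) := by ring
      rw [h1, Int.add_mul_ediv_left _ _ hpos.ne']
      have h2 : (c + s j) / Q + (-1 - (c + s j) / Q + Q * y) = (Q - 1) + Q * (y - 1) := by ring
      rw [h2, Int.add_mul_emod_self_left]
      exact Int.emod_eq_of_lt (by omega) (by omega)

theorem exists_translates_cover_compl (n : ℕ) (s : Fin n → ℤ) :
    ∃ d : Fin (2 ^ 2 ^ n) → ℤ, ∀ x : ℤ, ∃ i, ∀ j, x + d i + s j ∉ setA := by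
  obtain ⟨c, hc⟩ := exists_forall_not_mem_setA n (fun j => if h : j < n then s ⟨j, h⟩ else 0)
  refine ⟨fun i => (i : ℕ), fun x => ?_⟩
  have hpos : (0 : ℤ) < 2 ^ 2 ^ n := by positivity
  have h0 := Int.emod_nonneg (c - x) hpos.ne'
  have h1 := Int.emod_lt_of_pos (c - x) hpos
  have h2 := Int.emod_add_mul_ediv (c - x) (2 ^ 2 ^ n)
  refine ⟨⟨((c - x) % 2 ^ 2 ^ n).toNat, by zify; rwa [Int.toNat_of_nonneg h0]⟩, fun j => ?_⟩
  have h3 := hc j j.2 (-((c - x) / 2 ^ 2 ^ n))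
  simp only [Fin.is_lt, dite_true] at h3
  simp only [Int.toNat_of_nonneg h0]
  rwa [show x + (c - x) % 2 ^ 2 ^ n + s j = c + s j + 2 ^ 2 ^ n * -((c - x) / 2 ^ 2 ^ n) by
    linarith]

/-! ### Moving finitely many congruent integers into `setA` -/

/-- Digits of `a` are chosen from the lowest up; adding `2 ^ n` does not disturb positions below
`n`. -/
theorem exists_forall_digit_eq_zero (g : ℕ → ℤ) (n : ℕ) :
    ∃ a : ℤ, 0 ≤ a ∧ a < 2 ^ n ∧ ∀ p < n, (a + g p) / 2 ^ p % 2 = 0 := by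
  induction n with
  | zero => exact ⟨0, by simp⟩
  | succ n ih =>
    obtain ⟨a, h0, h1, h2⟩ := ih
    have hpos : (0 : ℤ) < 2 ^ n := by positivity
    set e := (a + g n) / 2 ^ n % 2 with he
    have he' : e = 0 ∨ e = 1 := by omega
    refine ⟨a + 2 ^ n * e, ?_, ?_, fun p hp => ?_⟩
    · rcases he' with h | h <;> rw [h] <;> linarith
    · rw [pow_succ]
      rcases he' with h | h <;> rw [h] <;> linarith
    · have hp' : (0 : ℤ) < 2 ^ p := by positivity
      rcases Nat.lt_succ_iff_lt_or_eq.1 hp with hp | rfl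
      · obtain ⟨k, rfl⟩ := Nat.exists_eq_add_of_lt hp
        have h3 : a + 2 ^ (p + k + 1) * e + g p = a + g p + 2 ^ p * (2 * (2 ^ k * e)) := by ring
        rw [h3, Int.add_mul_ediv_left _ _ hp'.ne', Int.add_mul_emod_self_left]
        exact h2 p hp
      · have h3 : a + 2 ^ p * e + g p = a + g p + 2 ^ p * e := by ring
        rw [h3, Int.add_mul_ediv_left _ _ hp'.ne']
        omega

theorem natCast_mem_setA {n : ℕ} (h : ∀ k, ∃ p ∈ block k, (n : ℤ) / 2 ^ p % 2 = 0) :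
    (n : ℤ) ∈ setA := by
  refine ⟨n, rfl, fun k => ?_⟩
  obtain ⟨p, hp, hn⟩ := h k
  refine ⟨p, hp, ?_⟩
  have : n / 2 ^ p % 2 = 0 := by exact_mod_cast hn
  simp [supp, Nat.testBit_eq_decide_div_mod_eq, this]

theorem exists_translate_mem_setA (r : ℕ) (x : ℕ → ℤ)
    (hx : ∀ i < r, ∀ j < r, (2 : ℤ) ^ 2 ^ r ∣ x i - x j) :
    ∃ a : ℤ, ∀ i < r, a + x i ∈ setA := by
  obtain ⟨B, hB⟩ : ∃ B : ℕ, ∀ i < r, |x i| < B := by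
    refine ⟨∑ i ∈ Finset.range r, (x i).natAbs + 1, fun i hi => ?_⟩
    have : (x i).natAbs ≤ ∑ i ∈ Finset.range r, (x i).natAbs := Finset.single_le_sum (f := fun i => (x i).natAbs) (fun _ _ => Nat.zero_le _)
      (Finset.mem_range.2 hi)
    rw [Int.abs_eq_natAbs]
    omega
  set l := B + 2 with hl
  have hBl : (B : ℤ) < 2 ^ 2 ^ l := by
    have h1 : B < 2 ^ B := Nat.lt_two_pow_self
    have h2 : 2 ^ B ≤ 2 ^ 2 ^ l :=
      Nat.pow_le_pow_right (by norm_num) ((by omega : B ≤ l).trans Nat.lt_two_pow_self.le)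
    exact_mod_cast h1.trans_le h2
  -- Position `p` is reserved for the integer with index `p % r`.
  obtain ⟨a, h0, h1, h2⟩ := exists_forall_digit_eq_zero (fun p => x (p % r)) (2 ^ l)
  -- The extra power of two makes all sums nonnegative without changing digits below `2 ^ l`.
  refine ⟨a + 2 ^ (2 ^ l + 1), fun i hi => ?_⟩
  have hxi := abs_lt.1 (hB i hi)
  have hp1 : (2 : ℤ) ^ (2 ^ l + 1) = 2 ^ 2 ^ l * 2 := pow_succ _ _
  obtain ⟨n, hn⟩ : ∃ n : ℕ, (n : ℤ) = a + 2 ^ (2 ^ l + 1) + x i :=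
    ⟨(a + 2 ^ (2 ^ l + 1) + x i).toNat, Int.toNat_of_nonneg (by linarith)⟩
  rw [← hn]
  refine natCast_mem_setA fun k => ?_
  rw [hn]
  have hlow : ∀ p < 2 ^ l, (2 : ℤ) ^ (p + 1) ∣ x i - x (p % r) →
      (a + 2 ^ (2 ^ l + 1) + x i) / 2 ^ p % 2 = 0 := by
    rintro p hp ⟨c, hc⟩
    obtain ⟨m, hm⟩ := Nat.exists_eq_add_of_lt hp
    have h3 : a + 2 ^ (2 ^ l + 1) + x i = a + x (p % r) + 2 ^ p * (2 * (c + 2 ^ (m + 1))) := by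
      rw [hm, sub_eq_iff_eq_add.1 hc]
      ring
    rw [h3, Int.add_mul_ediv_left _ _ (by positivity), Int.add_mul_emod_self_left]
    exact h2 p hp
  have hk2 : 2 ^ (k + 1) = 2 ^ k + 2 ^ k := by rw [pow_succ]; ring
  have hk0 : 0 < 2 ^ k := by positivity
  rcases lt_or_ge k l with hkl | hkl
  · have hkl' : 2 ^ (k + 1) ≤ 2 ^ l := Nat.pow_le_pow_right (by norm_num) hkl
    rcases lt_or_ge k r with hkr | hkr
    · have hkr' : 2 ^ (k + 1) ≤ 2 ^ r := Nat.pow_le_pow_right (by norm_num) hkr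
      -- All `x i` agree mod `2 ^ (2 ^ k + 1)`, so one zero digit serves them all.
      refine ⟨2 ^ k, ⟨le_rfl, by omega⟩, hlow _ (by omega) ?_⟩
      exact (pow_dvd_pow 2 (by omega)).trans (hx i hi _ (Nat.mod_lt _ (by omega)))
    · have hrk : r < 2 ^ k := hkr.trans_lt Nat.lt_two_pow_self
      -- some position in the block is congruent to `i` modulo `r`
      have hr : 0 < r := by omega
      have hdiv := Nat.mod_add_div (2 ^ k) r
      have hmod := Nat.mod_lt (2 ^ k) hr
      obtain ⟨p, hpl, hpu, hpm⟩ : ∃ p, 2 ^ k ≤ p ∧ p < 2 ^ k + r ∧ p % r = i := by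
        rcases le_or_gt (2 ^ k % r) i with h | h
        · refine ⟨i + r * (2 ^ k / r), by omega, by omega, ?_⟩
          rw [Nat.add_mul_mod_self_left, Nat.mod_eq_of_lt hi]
        · refine ⟨i + r * (2 ^ k / r + 1), by rw [mul_add]; omega, by rw [mul_add]; omega, ?_⟩
          rw [Nat.add_mul_mod_self_left, Nat.mod_eq_of_lt hi]
      refine ⟨p, ⟨hpl, by omega⟩, hlow p (by omega) ?_⟩
      rw [hpm, sub_self]
      exact dvd_zero _
  · have hkl' : 2 ^ l ≤ 2 ^ k := Nat.pow_le_pow_right (by norm_num) hkl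
    have h4 : 4 ≤ 2 ^ l := by
      calc 4 = 2 ^ 2 := by norm_num
        _ ≤ 2 ^ l := Nat.pow_le_pow_right (by norm_num) (by omega)
    -- The sums are below `2 ^ (2 ^ l + 2)`, so the top digit of such a block is zero.
    refine ⟨2 ^ (k + 1) - 1, ⟨by omega, by omega⟩, ?_⟩
    have h5 : (2 : ℤ) ^ (2 ^ l + 2) ≤ 2 ^ (2 ^ (k + 1) - 1) :=
      pow_le_pow_right₀ (by norm_num) (by omega)
    have h6 : (2 : ℤ) ^ (2 ^ l + 2) = 2 ^ 2 ^ l * 4 := by rw [pow_add]; norm_num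
    rw [Int.ediv_eq_zero_of_lt (by linarith) (by linarith)]
    rfl

/-- Two of the `q ^ r + 1` vectors of initial sums agree mod `q`; `H` is the interval between them.
-/
theorem exists_nonempty_sum_dvd (r : ℕ) (q : ℕ) [NeZero q] :
    ∃ N : ℕ, ∀ f : Fin r → Fin N → ℤ, ∃ H : Finset (Fin N), H.Nonempty ∧
      ∀ i, (q : ℤ) ∣ ∑ j ∈ H, f i j := by
  obtain ⟨N, hN⟩ : ∃ N, N = Fintype.card (Fin r → ZMod q) := ⟨_, rfl⟩
  refine ⟨N, fun f => ?_⟩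
  let S : Fin (N + 1) → Finset (Fin N) := fun m => Finset.univ.filter fun j => (j : ℕ) < m
  obtain ⟨m, m', hne, heq⟩ := Fintype.exists_ne_map_eq_of_card_lt
    (fun m i => ((∑ j ∈ S m, f i j : ℤ) : ZMod q)) (by simp [hN])
  wlog hlt : m < m' generalizing m m'
  · exact this m' m hne.symm heq.symm (lt_of_le_of_ne (not_lt.1 hlt) hne.symm)
  have hsub : S m ⊆ S m' := fun j hj => by
    simp only [S, Finset.mem_filter, Finset.mem_univ, true_and] at hj ⊢
    exact hj.trans hlt
  refine ⟨S m' \ S m, ⟨⟨m, by omega⟩, by simp [S, hlt]⟩, fun i => ?_⟩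
  rw [← ZMod.intCast_zmod_eq_zero_iff_dvd, Finset.sum_sdiff_eq_sub hsub]
  have := congrFun heq i
  rw [Int.cast_sub, this, sub_self]

theorem exists_sum_add_mem_setA (r : ℕ) :
    ∃ N : ℕ, ∀ f : Fin r → Fin N → ℤ, ∃ a : ℤ, ∃ H : {H : Finset (Fin N) // H.Nonempty},
      ∀ i, a + ∑ j ∈ H.1, f i j ∈ setA := by
  obtain ⟨N, hN⟩ := exists_nonempty_sum_dvd r (2 ^ 2 ^ r)
  refine ⟨N, fun f => ?_⟩
  obtain ⟨H, hH, hd⟩ := hN f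
  obtain ⟨a, ha⟩ := exists_translate_mem_setA r
    (fun i => if h : i < r then ∑ j ∈ H, f ⟨i, h⟩ j else 0) (fun i hi j hj => by
      simp only [hi, hj, dite_true]
      exact_mod_cast dvd_sub (hd ⟨i, hi⟩) (hd ⟨j, hj⟩))
  exact ⟨a, ⟨H, hH⟩, fun i => by simpa using ha i i.2⟩

end JProp

/-! ### Saturation of ultraproducts over `ℕ` -/

namespace FirstOrder.Language

open Filter

theorem Ultraproduct.isAleph0Saturated {L : Language.{u, v}} [Countable L.Symbols]
    (M : ℕ → Type w) [∀ a, L.Structure (M a)] [∀ a, Nonempty (M a)] :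
    JProp.IsAleph0Saturated L ((hyperfilter ℕ : Filter ℕ).Product M) := by
  intro P hP Γ hΓ
  have : Finite P := hP
  have hrep : ∀ x : (hyperfilter ℕ : Filter ℕ).Product M, ∃ y : ∀ a, M a, ↑y = x :=
    Quotient.exists_rep
  choose rep hrep using hrep
  let ψ : L[[P]].Formula Unit → L.Formula (P ⊕ Unit) := BoundedFormula.constantsVarsEquiv
  let val (z : ∀ a, M a) (a : ℕ) : P ⊕ Unit → M a := Sum.elim (fun p => rep p a) fun _ => z a
  have hψ (φ : L[[P]].Formula Unit) (z : ∀ a, M a) :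
      φ.Realize (M := (hyperfilter ℕ : Filter ℕ).Product M) (fun _ => z) ↔
        ∀ᶠ a in (hyperfilter ℕ : Filter ℕ), (ψ φ).Realize (val z a) := by
    refine BoundedFormula.realize_constantsVarsEquiv.symm.trans ?_
    have := Ultraproduct.realize_formula_cast (u := hyperfilter ℕ) (ψ φ)
      (Sum.elim (fun p : P => rep p) (fun _ => z))
    convert! this using 3
    · refine iff_of_eq (congrArg₂ (BoundedFormula.Realize (ψ φ)) (funext ?_)
        (Subsingleton.elim _ _))
      rintro (p | _)
      · exact (hrep p).symm
      · rfl
    · refine iff_of_eq (congrArg (ψ φ).Realize (funext ?_))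
      rintro (p | _) <;> rfl
  rcases Γ.eq_empty_or_nonempty with rfl | hne
  · obtain ⟨x, -⟩ := hΓ ∅ (by simp)
    exact ⟨x, by simp⟩
  obtain ⟨φ, rfl⟩ := (Set.to_countable Γ).exists_eq_range hne
  let good (n a : ℕ) : Prop := ∃ z : M a, ∀ k < n, (ψ (φ k)).Realize
    (Sum.elim (fun p : P => rep p a) fun _ => z)
  have hgood (n : ℕ) : ∀ᶠ a in (hyperfilter ℕ : Filter ℕ), good n a := by
    classical
    obtain ⟨x, hx⟩ := hΓ ((Finset.range n).image φ) (by
      intro χ hχ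
      obtain ⟨k, -, rfl⟩ := Finset.mem_image.1 (Finset.mem_coe.1 hχ)
      exact ⟨k, rfl⟩)
    have h1 : ∀ k ∈ Finset.range n, ∀ᶠ a in (hyperfilter ℕ : Filter ℕ),
        (ψ (φ k)).Realize (val (rep x) a) := fun k hk => by
      rw [← hψ, hrep]
      exact hx _ (Finset.mem_image_of_mem _ hk)
    filter_upwards [(Filter.eventually_all_finset _).2 h1] with a ha
    exact ⟨rep x a, fun k hk => ha k (Finset.mem_range.2 hk)⟩
  classical
  have hg0 (a : ℕ) : good 0 a := ⟨Classical.arbitrary _, fun k hk => absurd hk (Nat.not_lt_zero k)⟩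
  -- In factor `a`, satisfy as many initial formulas as possible, at most `a`; each formula is then
  -- met at almost every `a`.
  let N (a : ℕ) : ℕ := Nat.findGreatest (fun n => good n a) a
  have hN (a : ℕ) : good (N a) a :=
    Nat.findGreatest_spec (P := fun n => good n a) (Nat.zero_le a) (hg0 a)
  choose z hz using hN
  refine ⟨(z : (hyperfilter ℕ : Filter ℕ).Product M), ?_⟩
  rintro _ ⟨k, rfl⟩
  rw [hψ]
  have hlarge : ∀ᶠ a in (hyperfilter ℕ : Filter ℕ), k + 1 ≤ a :=
    Nat.hyperfilter_le_atTop (eventually_ge_atTop (k + 1))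
  filter_upwards [hgood (k + 1), hlarge] with a h1 h2
  exact hz a k (Nat.lt_of_succ_le (Nat.le_findGreatest (P := fun n => good n a) h2 h1))

end FirstOrder.Language

namespace JProp

open Filter

instance : Countable lang.Symbols := by
  have h1 : Countable (Σ n, FuncSym n) :=
    (Function.Injective.countable (f := fun _ => (0 : ℕ)) (by rintro ⟨_, ⟨⟩⟩ ⟨_, ⟨⟩⟩ _; rfl))
  have h2 : Countable (Σ n, RelSym n) :=
    (Function.Injective.countable (f := fun _ => (0 : ℕ)) (by rintro ⟨_, ⟨⟩⟩ ⟨_, ⟨⟩⟩ _; rfl))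
  exact inferInstanceAs (Countable ((Σ n, FuncSym n) ⊕ (Σ n, RelSym n)))

/-- The integers as a model of their complete theory, in an arbitrary universe. -/
noncomputable def intModel : theoryT.ModelType.{0, 0, w} :=
  FirstOrder.Language.Theory.ModelType.ulift.{0, 0, 0, w}
    (haveI := FirstOrder.Language.model_completeTheory (L := lang) (M := ℤ)
     FirstOrder.Language.Theory.ModelType.of (lang.completeTheory ℤ) ℤ)

theorem exists_isAleph0Saturated :
    ∃ M : theoryT.ModelType.{0, 0, w}, IsAleph0Saturated lang M := by
  have hmodel : (hyperfilter ℕ : Filter ℕ).Product (fun _ : ℕ => intModel.{w}) ⊨ theoryT := by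
    rw [FirstOrder.Language.Theory.model_iff]
    intro φ hφ
    rw [FirstOrder.Language.Ultraproduct.sentence_realize]
    exact Eventually.of_forall fun _ => intModel.is_model.realize_of_mem φ hφ
  exact ⟨FirstOrder.Language.Theory.ModelType.of theoryT
    ((hyperfilter ℕ : Filter ℕ).Product (fun _ : ℕ => intModel.{w})),
    FirstOrder.Language.Ultraproduct.isAleph0Saturated _⟩

/-! ### Transfer of the two uniform facts to all models -/

/-- The sum of a term and a list of terms. -/
def sumTerm {α : Type} (s : lang.Term α) (l : List (lang.Term α)) : lang.Term α :=
  l.foldl addTerm s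

/-- The formula `t ∈ 𝔸`. -/
def memFormula {α : Type} (t : lang.Term α) : lang.Formula α :=
  FirstOrder.Language.Relations.formula₁ (L := lang) RelSym.A t

theorem realize_memFormula {N : Type w} [lang.Structure N] {α : Type} (t : lang.Term α)
    (v : α → N) : (memFormula t).Realize v ↔ t.realize v ∈ predA N :=
  FirstOrder.Language.Formula.realize_rel₁

theorem realize_sumTerm {N : Type w} [lang.Structure N] [AddCommGroup N]
    (hN : ∀ x y : N, opAdd x y = x + y) {α : Type} (v : α → N) (s : lang.Term α)
    (l : List (lang.Term α)) :
    (sumTerm s l).realize v = s.realize v + (l.map fun t => t.realize v).sum := by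
  induction l generalizing s with
  | nil => simp [sumTerm]
  | cons t l ih =>
    have := ih (addTerm s t)
    rw [sumTerm] at this ⊢
    rw [List.foldl_cons, this, realize_addTerm, hN, List.map_cons, List.sum_cons, add_assoc]

open FirstOrder.Language in
/-- For all `f i j` there are `a` and a nonempty `H` with `a + ∑ j ∈ H, f i j ∈ 𝔸` for all `i`. -/
noncomputable def sumSentence (r n : ℕ) : lang.Sentence :=
  Formula.iAlls (Fin r × Fin n) <| Formula.iExs Unit <|
    Formula.iSup fun H : {H : Finset (Fin n) // H.Nonempty} => Formula.iInf fun i : Fin r =>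
      memFormula (sumTerm (Term.var (Sum.inr ()))
        (H.1.toList.map fun j => Term.var (Sum.inl (Sum.inr (i, j)))))

open FirstOrder.Language in
theorem realize_sumSentence {N : Type w} [lang.Structure N] [AddCommGroup N]
    (hN : ∀ x y : N, opAdd x y = x + y) (r n : ℕ) :
    N ⊨ sumSentence r n ↔ ∀ f : Fin r × Fin n → N, ∃ a : Unit → N,
      ∃ H : {H : Finset (Fin n) // H.Nonempty}, ∀ i, a () + ∑ j ∈ H.1, f (i, j) ∈ predA N := by
  simp only [sumSentence, Sentence.Realize, Formula.realize_iAlls, Formula.realize_iExs,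
    Formula.realize_iSup, Formula.realize_iInf, realize_memFormula, realize_sumTerm hN,
    Term.realize_var, List.map_map, Function.comp_def, Sum.elim_inr, Sum.elim_inl,
    Finset.sum_map_toList]

theorem exists_sum_add_mem_predA (r : ℕ) :
    ∃ n : ℕ, ∀ (M : theoryT.ModelType.{0, 0, w}) (f : Fin r → Fin n → M),
      ∃ a : M, ∃ H : {H : Finset (Fin n) // H.Nonempty}, ∀ i, a + ∑ j ∈ H.1, f i j ∈ predA M := by
  obtain ⟨n, hn⟩ := exists_sum_add_mem_setA r
  refine ⟨n, fun M f => ?_⟩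
  have hint : ℤ ⊨ sumSentence r n := (realize_sumSentence opAdd_int r n).2 fun f => by
    obtain ⟨a, ha⟩ := hn fun i j => f (i, j)
    exact ⟨fun _ => a, ha⟩
  obtain ⟨a, ha⟩ := (realize_sumSentence (model_add_def M) r n).1
    (realize_of_int M _ hint) fun p => f p.1 p.2
  exact ⟨a (), ha⟩

open FirstOrder.Language in
/-- For all `s j` there are `q` elements `d i` such that every `x` has a translate `x + d i` with
`x + d i + s j ∉ 𝔸` for all `j`. -/
noncomputable def coverSentence (n q : ℕ) : lang.Sentence :=
  Formula.iAlls (Fin n) <| Formula.iExs (Fin q) <|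
    Formula.iAlls Unit <| Formula.iSup fun i : Fin q => Formula.iInf fun j : Fin n =>
      (memFormula (addTerm (addTerm (Term.var (Sum.inr ())) (Term.var (Sum.inl (Sum.inr i))))
        (Term.var (Sum.inl (Sum.inl (Sum.inr j)))))).not

open FirstOrder.Language in
theorem realize_coverSentence {N : Type w} [lang.Structure N] [AddCommGroup N]
    (hN : ∀ x y : N, opAdd x y = x + y) (n q : ℕ) :
    N ⊨ coverSentence n q ↔ ∀ s : Fin n → N, ∃ d : Fin q → N,
      ∀ x : Unit → N, ∃ i, ∀ j, x () + d i + s j ∉ predA N := by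
  simp only [coverSentence, Sentence.Realize, Formula.realize_iAlls, Formula.realize_iExs,
    Formula.realize_iSup, Formula.realize_iInf, Formula.realize_not, realize_memFormula,
    realize_addTerm, hN, Term.realize_var, Sum.elim_inr, Sum.elim_inl]

theorem exists_translates_cover_compl_predA (n : ℕ) :
    ∃ q : ℕ, ∀ (M : theoryT.ModelType.{0, 0, w}) (s : Fin n → M),
      ∃ d : Fin q → M, ∀ x : M, ∃ i, ∀ j, x + d i + s j ∉ predA M := by
  refine ⟨2 ^ 2 ^ n, fun M s => ?_⟩
  have hint : ℤ ⊨ coverSentence n (2 ^ 2 ^ n) := (realize_coverSentence opAdd_int n _).2 fun s => by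
    obtain ⟨d, hd⟩ := exists_translates_cover_compl n s
    exact ⟨d, fun x => hd (x ())⟩
  obtain ⟨d, hd⟩ := (realize_coverSentence (model_add_def M) n _).1 (realize_of_int M _ hint) s
  exact ⟨d, fun x => hd fun _ => x⟩

/-! ### From the uniform facts to J-sets and weak genericity -/

theorem isJSet_of_exists_sum_add_mem {G : Type w} [AddCommGroup G] {X : Set G}
    (h : ∀ r : ℕ, ∃ n : ℕ, ∀ f : Fin r → Fin n → G,
      ∃ a : G, ∃ H : {H : Finset (Fin n) // H.Nonempty}, ∀ i, a + ∑ j ∈ H.1, f i j ∈ X) :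
    IsJSet X := by
  intro F
  obtain ⟨n, hn⟩ := h F.card
  obtain ⟨a, ⟨H, hH⟩, ha⟩ := hn fun i j => (F.equivFin.symm i).1 j
  -- By commutativity the last coefficient can carry all of `a`.
  refine ⟨H.card, hH.card_pos, fun k => (H.orderEmbOfFin rfl k : Fin n),
    fun k l hkl => (H.orderEmbOfFin rfl).strictMono hkl, Fin.snoc 0 a, fun f hf => ?_⟩
  have hsum : ∑ k, f (H.orderEmbOfFin rfl k : Fin n) = ∑ j ∈ H, f j := by
    conv_rhs => rw [← Finset.map_orderEmbOfFin_univ H rfl, Finset.sum_map]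
    rfl
  have := ha (F.equivFin ⟨f, hf⟩)
  simp only [Equiv.symm_apply_apply] at this
  simpa [chi, List.sum_ofFn, hsum, add_comm] using this

/-- Move `x` by some `d i` out of all the translates of `X` used; the translates of `Y` must catch
it there, so shifting them back by the `d i` covers `G`. -/
theorem IsGenericSet.of_union {G : Type w} [AddCommGroup G] {X Y : Set G}
    (h : ∀ n : ℕ, ∃ q : ℕ, ∀ s : Fin n → G,
      ∃ d : Fin q → G, ∀ x : G, ∃ i, ∀ j, x + d i + s j ∉ X)
    (hXY : IsGenericSet (X ∪ Y)) : IsGenericSet Y := by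
  classical
  obtain ⟨S, hS⟩ := hXY
  obtain ⟨q, hq⟩ := h S.card
  obtain ⟨d, hd⟩ := hq fun j => -(S.equivFin.symm j).1
  refine ⟨(S ×ˢ Finset.univ).image fun p : G × Fin q => p.1 - d p.2, fun x => ?_⟩
  obtain ⟨i, hi⟩ := hd x
  obtain ⟨g, hg, y, hy, hgy⟩ := hS (x + d i)
  refine ⟨g - d i, Finset.mem_image.2 ⟨(g, i), by simp [hg], rfl⟩, y, hy.resolve_left ?_, ?_⟩
  · have h1 := hi (S.equivFin ⟨g, hg⟩)
    rw [← hgy] at h1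
    simpa using h1
  · rw [sub_add_eq_add_sub, hgy, add_sub_cancel_right]

theorem isJSet_predA (M : theoryT.ModelType.{0, 0, w}) : IsJSet (predA M) :=
  isJSet_of_exists_sum_add_mem fun r =>
    let ⟨n, hn⟩ := exists_sum_add_mem_predA r
    ⟨n, hn M⟩

theorem not_isWeaklyGeneric_predA (M : theoryT.ModelType.{0, 0, w}) :
    ¬ IsWeaklyGeneric lang (predA M) := by
  rintro ⟨Y, -, hY, hAY⟩
  refine hY (hAY.of_union fun n => ?_)
  obtain ⟨q, hq⟩ := exists_translates_cover_compl_predA n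
  exact ⟨q, hq M⟩

theorem isDefinableSet_predA (M : Type w) [lang.Structure M] : IsDefinableSet lang (predA M) := by
  have h : (∅ : Set M).Definable₁ lang (predA M) := by
    rw [Set.Definable₁, Set.empty_definable_iff]
    refine ⟨memFormula (FirstOrder.Language.Term.var 0), ?_⟩
    ext x
    rw [Set.mem_ofPred_eq, Set.mem_ofPred_eq, realize_memFormula]
    rfl
  exact h.mono (Set.empty_subset _)

end JProp

theorem mainTheorem2 :
    -- in every `ℵ₀`-saturated model (in particular in a monster model), the interpretation of
    -- `𝔸` is a J-set that is not weakly generic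
    (∀ M : JProp.theoryT.ModelType.{0, 0, w}, JProp.IsAleph0Saturated JProp.lang M →
      JProp.IsJSet (JProp.predA M) ∧ ¬ JProp.IsWeaklyGeneric JProp.lang (JProp.predA M)) ∧
    -- hence definable J-sets and weakly generic sets differ in every `ℵ₀`-saturated model
    (¬ ∃ M : JProp.theoryT.ModelType.{0, 0, w}, JProp.IsAleph0Saturated JProp.lang M ∧
      JProp.JSetsAreWeaklyGenericSets JProp.lang M) ∧
    -- and, as such models exist, the J-property fails
    ¬ JProp.HasJProperty.{w} := by
  refine ⟨fun M _ => ⟨JProp.isJSet_predA M, JProp.not_isWeaklyGeneric_predA M⟩, ?_, fun h => ?_⟩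
  · rintro ⟨M, -, h⟩
    exact JProp.not_isWeaklyGeneric_predA M
      ((h _ (JProp.isDefinableSet_predA M)).1 (JProp.isJSet_predA M))
  · obtain ⟨M, hM⟩ := JProp.exists_isAleph0Saturated.{w}
    exact JProp.not_isWeaklyGeneric_predA M
      ((h M hM _ (JProp.isDefinableSet_predA M)).1 (JProp.isJSet_predA M))
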